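/- Let $L\ge 1$, let $0<\alpha_M<\alpha_Q$, and for $\ell=1,\dots,L$ let $\mu_{M,\ell},\mu_{Q,\ell},\Omega_{M,\ell},\Omega_{Q,\ell}>0$. For $a\in\{M,Q\}$, the $\bar\alpha$-$\bar\mu$ distribution with parameters $(\alpha_a,\mu_{a,\ell},\Omega_{a,\ell})$ is the distribution on $(0,\infty)$ with density $$x\mapsto \frac{\alpha_a\,\mu_{a,\ell}^{\mu_{a,\ell}}\,x^{\alpha_a\mu_{a,\ell}-1}}{\Omega_{a,\ell}^{\alpha_a\mu_{a,\ell}}\,\Gamma(\mu_{a,\ell})}\exp\!\Big(-\mu_{a,\ell}\frac{x^{\alpha_a}}{\Omega_{a,\ell}^{\alpha_a}}\Big),\qquad x>0 .$$ For each $\ell$ let $M_\ell$ and $Q_\ell$ be independent random variables having the $\bar\alpha$-$\bar\mu$ distributions with parameters $(\alpha_M,\mu_{M,\ell},\Omega_{M,\ell})$ and $(\alpha_Q,\mu_{Q,\ell},\Omega_{Q,\ell})$, put $Z_\ell=M_\ell/Q_\ell$, and suppose that $Z_1,\dots,Z_L$ are independent (not necessarily identically distributed). Put $Z=\sum_{\ell=1}^L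 Z_\ell$ and $$\tilde\varrho_\ell=\frac{\Omega_{Q,\ell}\,\mu_{M,\ell}^{1/\alpha_M}}{\Omega_{M,\ell}\,\mu_{Q,\ell}^{1/\alpha_Q}},\qquad u_{i,\ell}=\frac{(-1)^i}{i!}\,\Gamma\big(\alpha_M(i+\mu_{M,\ell})\big)\,\Gamma\Big(\frac{\alpha_M(i+\mu_{M,\ell})}{\alpha_Q}+\mu_{Q,\ell}\Big)\,\tilde\varrho_\ell^{\,\alpha_M(\mu_{M,\ell}+i)}\quad(i\ge 0).$$ Define $$\phi_{0,\ell}=\frac{u_{1,\ell}}{u_{0,\ell}},\qquad \phi_{h,\ell}=\frac1{u_{0,\ell}}\Big[(h+1)u_{h+1,\ell}-\sum_{t=1}^h u_{t,\ell}\,\phi_{h-t,\ell}\Big]\quad(h\ge1),$$ $$\delta_0=\prod_{\ell=1}^L u_{0,\ell},\qquad \delta_i=\frac1i\sum_{h=1}^i\delta_{i-h}\sum_{\ell=1}^L\phi_{h-1,\ell}\quad(i\ge1).$$ Then the following hold, all the series being absolutely convergent. (a) Each $Z_\ell$ has the density $$f_{Z_\ell}(z)=\frac{\alpha_M}{z\,\Gamma(\mu_{M,\ell})\Gamma(\mu_{Q,\ell})}\sum_{i=0}^\infty\frac{(-1)^i}{i!}(\tilde\varrho_\ell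 z)^{\alpha_M(i+\mu_{M,\ell})}\,\Gamma\Big(\frac{\alpha_M(i+\mu_{M,\ell})}{\alpha_Q}+\mu_{Q,\ell}\Big)\quad(z>0),\qquad f_{Z_\ell}(z)=0\quad(z\le 0).$$ (b) For every $\ell$ and every $\varepsilon>0$, $\displaystyle\lim_{i\to\infty}\frac{|u_{i,\ell}|}{\Gamma(i\alpha_M+\varepsilon)}=0$. (c) $Z$ has the density $$f_Z(z)=\Big(\prod_{\ell=1}^L\frac{\alpha_M}{\Gamma(\mu_{M,\ell})\Gamma(\mu_{Q,\ell})}\Big)\sum_{i=0}^\infty\frac{\delta_i\,z^{-1+i\alpha_M+\alpha_M\sum_{\ell=1}^L\mu_{M,\ell}}}{\Gamma\big(i\alpha_M+\alpha_M\sum_{\ell=1}^L\mu_{M,\ell}\big)}\quad(z>0),\qquad f_Z(z)=0\quad(z\le0).$$ (d) The distribution function of $Z$ is $$F_Z(z)=\Big(\prod_{\ell=1}^L\frac{\alpha_M}{\Gamma(\mu_{M,\ell})\Gamma(\mu_{Q,\ell})}\Big)\sum_{i=0}^\infty\frac{\delta_i\,z^{i\alpha_M+\alpha_M\sum_{\ell=1}^L\mu_{M,\ell}}}{\Gamma\big(1+i\alpha_M+\alpha_M\sum_{\ell=1}^L\mu_{M,\ell}\big)}\quad(z\ge0).$$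 -/

import Mathlib

namespace FadingSum

open MeasureTheory

/-- `f` is a probability density function (with respect to Lebesgue measure) of the law `ν`. -/
def IsPDF (ν : Measure ℝ) (f : ℝ → ℝ) : Prop :=
  Measurable f ∧ (∀ x, 0 ≤ f x) ∧ ν = volume.withDensity (fun x => ENNReal.ofReal (f x))

/-- The density of the `ᾱ-μ̄` distribution with nonlinearity parameter `α`, number of clusters `μ`
and `α`-root mean value `Ω`; it vanishes off the positive half-line. -/
noncomputable def alphaMuPDF (α μ Ω : ℝ) (x : ℝ) : ℝ :=
  (Set.Ioi (0 : ℝ)).indicator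
    (fun x => α * μ ^ μ * x ^ (α * μ - 1) / (Ω ^ (α * μ) * Real.Gamma μ)
      * Real.exp (-(μ * (x ^ α / Ω ^ α)))) x

/-- The `ᾱ-μ̄` distribution, as a measure on `ℝ`. -/
noncomputable def alphaMuLaw (α μ Ω : ℝ) : Measure ℝ :=
  volume.withDensity (fun x => ENNReal.ofReal (alphaMuPDF α μ Ω x))

/-- The coefficients `φ_h` built from a sequence `η`:
`φ_0 = η_1 / η_0` and `φ_h = η_0⁻¹ [(h+1) η_{h+1} - ∑_{t=1}^h η_t φ_{h-t}]` for `h ≥ 1`.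
In the second clause `h` stands for `h - 1` and `t` for `t - 1`. -/
noncomputable def phi (η : ℕ → ℝ) : ℕ → ℝ
  | 0 => η 1 / η 0
  | h + 1 => 1 / η 0 * (((h : ℝ) + 2) * η (h + 2)
      - ∑ t : Fin (h + 1), η ((t : ℕ) + 1) * phi η (h - (t : ℕ)))
  decreasing_by omega

/-- The coefficients `δ_i` built from sequences `η_1, …, η_L`:
`δ_0 = ∏_ℓ η_{0,ℓ}` and `δ_i = i⁻¹ ∑_{h=1}^i δ_{i-h} ∑_ℓ φ_{h-1,ℓ}` for `i ≥ 1`.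
In the second clause `i` stands for `i - 1` and `h` for `h - 1`. -/
noncomputable def delta {L : ℕ} (η : Fin L → ℕ → ℝ) : ℕ → ℝ
  | 0 => ∏ l, η l 0
  | i + 1 => 1 / ((i : ℝ) + 1) *
      ∑ h : Fin (i + 1), delta η (i - (h : ℕ)) * ∑ l, phi (η l) (h : ℕ)
  decreasing_by omega

/-- The `i`-th term of the series for the density of the sum (without the factor `∏ Ψ_ℓ`). -/
noncomputable def pdfTerm {L : ℕ} (θ : ℝ) (β : Fin L → ℝ) (η : Fin L → ℕ → ℝ)
    (x : ℝ) (i : ℕ) : ℝ :=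
  delta η i * x ^ (-1 + θ * i + ∑ l, β l) / Real.Gamma (i * θ + ∑ l, β l)

/-- The `i`-th term of the series for the distribution function of the sum
(without the factor `∏ Ψ_ℓ`). -/
noncomputable def cdfTerm {L : ℕ} (θ : ℝ) (β : Fin L → ℝ) (η : Fin L → ℕ → ℝ)
    (x : ℝ) (i : ℕ) : ℝ :=
  delta η i * x ^ (θ * i + ∑ l, β l) / Real.Gamma (1 + i * θ + ∑ l, β l)

/-- The scale `ϱ̃` of a ratio of `ᾱ-μ̄` variates. -/
noncomputable def rhoTilde (αM αQ μM μQ ΩM ΩQ : ℝ) : ℝ :=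
  ΩQ * μM ^ (1 / αM) / (ΩM * μQ ^ (1 / αQ))

/-- The coefficients `u_i` of a ratio of `ᾱ-μ̄` variates, with `ϱ = ϱ̃`. -/
noncomputable def u (αM αQ μM μQ ϱ : ℝ) (i : ℕ) : ℝ :=
  (-1) ^ i * Real.Gamma (αM * (i + μM)) * Real.Gamma (αM * (i + μM) / αQ + μQ)
    * ϱ ^ (αM * (μM + i)) / (i.factorial : ℝ)

/-- The `i`-th term of the series for the density of one ratio
(without the factor `αM / (z Γ(μM) Γ(μQ))`), with `ϱ = ϱ̃`. -/
noncomputable def ratioTerm (αM αQ μM μQ ϱ : ℝ) (z : ℝ) (i : ℕ) : ℝ :=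
  (-1) ^ i / (i.factorial : ℝ) * (ϱ * z) ^ (αM * (i + μM))
    * Real.Gamma (αM * (i + μM) / αQ + μQ)

end FadingSum

/-!
The kernels `x ↦ x ^ (s - 1) / Γ(s)` on the positive half-line form a convolution semigroup in `s`.
Hence, writing a density as a series of kernels of orders `θ i + β`, convolution of densities
becomes multiplication of the power series of coefficients, with the `β`s added; the distribution
function is the convolution with the kernel of order `1`, which only shifts `β`. The recursion for
`δ` computes the product of the power series `∑ η_{i,ℓ} X ^ i` because `φ_ℓ` is the logarithmic
derivative of the `ℓ`-th factor.

The density of a ratio `M / Q` at `z` is `E[Q f_M(Q z)]`; expanding the exponential in `f_M` and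
integrating termwise leaves moments of `Q`, which are Gamma values. Since `αM < αQ`, these grow
like `Γ(r i + c)` with `r < 1`, so the factor `1 / i!` makes the series converge everywhere.
-/

namespace FadingSum

open MeasureTheory ProbabilityTheory Set Filter Topology
open PowerSeries (coeff coeff_C_mul coeff_mk coeff_mul coeff_one C mk)
open scoped Convolution ENNReal PowerSeries

section RecursiveCoefficients

open Finset

theorem sum_antidiagonal_mul_phi {η : ℕ → ℝ} (h0 : η 0 ≠ 0) (h : ℕ) :
    ∑ p ∈ antidiagonal h, η p.1 * phi η p.2 = η (h + 1) * (h + 1) := by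
  rcases h with _ | h
  · simp only [Finset.Nat.antidiagonal_zero, sum_singleton, phi]
    field_simp
    simp
  · rw [Nat.sum_antidiagonal_succ, phi, Nat.sum_antidiagonal_eq_sum_range_succ
      (fun i j => η (i + 1) * phi η j) h, Finset.sum_range]
    push_cast
    field_simp
    ring

theorem derivative_mk {η : ℕ → ℝ} (h0 : η 0 ≠ 0) :
    PowerSeries.derivative ℝ (.mk η) = .mk η * .mk (phi η) := by
  ext n
  simp [PowerSeries.coeff_derivative, coeff_mul, sum_antidiagonal_mul_phi h0]

theorem derivative_prod_mk {ι : Type*} {s : Finset ι} {η : ι → ℕ → ℝ}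
    (h0 : ∀ l ∈ s, η l 0 ≠ 0) :
    PowerSeries.derivative ℝ (∏ l ∈ s, .mk (η l)) =
      (∏ l ∈ s, .mk (η l)) * ∑ l ∈ s, .mk (phi (η l)) := by
  induction s using Finset.cons_induction with
  | empty => simp
  | cons a s ha ih =>
    rw [prod_cons, sum_cons, Derivation.leibniz, derivative_mk (h0 a (mem_cons_self a s)),
      ih fun l hl => h0 l (mem_cons_of_mem hl)]
    simp only [smul_eq_mul]
    ring

theorem mk_delta {L : ℕ} {η : Fin L → ℕ → ℝ} (h0 : ∀ l, η l 0 ≠ 0) :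
    mk (delta η) = ∏ l, .mk (η l) := by
  ext i
  rw [coeff_mk]
  induction i using Nat.strong_induction_on with
  | _ i ih =>
    rcases i with _ | i
    · rw [delta, PowerSeries.coeff_zero_eq_constantCoeff, map_prod]
      simp
    · have key := congrArg (coeff i) (derivative_prod_mk (s := univ) fun l _ => h0 l)
      rw [PowerSeries.coeff_derivative, mul_comm (∏ l, _),
        coeff_mul, Nat.sum_antidiagonal_eq_sum_range_succ_mk] at key
      rw [delta, one_div, inv_mul_eq_iff_eq_mul₀ (by positivity), mul_comm, key, sum_range]
      refine sum_congr rfl fun h _ => ?_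
      rw [ih _ (by omega), mul_comm]
      simp

end RecursiveCoefficients

section Series

variable {α ι : Type*} [MeasurableSpace α] [Countable ι] {m : Measure α} {F : ι → α → ℝ}

theorem integrable_tsum (hF : ∀ i, Integrable (F i) m) (hs : Summable fun i => ∫ a, ‖F i a‖ ∂m)
    (hm : AEStronglyMeasurable (fun a => ∑' i, F i a) m) :
    Integrable (fun a => ∑' i, F i a) m := by
  refine ⟨hm, ?_⟩
  calc ∫⁻ a, ‖∑' i, F i a‖ₑ ∂m ≤ ∫⁻ a, ∑' i, ‖F i a‖ₑ ∂m :=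
        lintegral_mono fun a => enorm_tsum_le_tsum_enorm
    _ = ∑' i, ENNReal.ofReal (∫ a, ‖F i a‖ ∂m) := by
        rw [lintegral_tsum fun i => (hF i).1.enorm]
        simp_rw [ofReal_integral_norm_eq_lintegral_enorm (hF _)]
    _ < ⊤ := hs.tsum_ofReal_ne_top.lt_top

end Series

open Finset.HasAntidiagonal in
theorem hasSum_sum_antidiagonal {f : ℕ × ℕ → ℝ} {a : ℝ} (hf : HasSum f a) :
    HasSum (fun n => ∑ p ∈ antidiagonal n, f p) a :=
  ((sigmaAntidiagonalEquivProd (A := ℕ)).hasSum_iff.2 hf).sigma fun n => (antidiagonal n).hasSum f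

section Kernel

theorem intervalIntegral_rpow_mul_sub_rpow {s t x : ℝ} (hs : 0 < s) (ht : 0 < t) (hx : 0 < x) :
    ∫ y in 0..x, y ^ (s - 1) * (x - y) ^ (t - 1) = x ^ (s + t - 1) * beta s t := by
  apply Complex.ofReal_injective
  have hbeta : Complex.betaIntegral s t = beta s t := by
    rw [Complex.betaIntegral_eq_Gamma_mul_div _ _ (by simpa) (by simpa), beta,
      ← Complex.ofReal_add]
    simp only [Complex.Gamma_ofReal]
    norm_cast
  rw [← intervalIntegral.integral_ofReal, Complex.ofReal_mul, Complex.ofReal_cpow hx.le, ← hbeta]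
  push_cast
  rw [← Complex.betaIntegral_scaled s t hx]
  refine intervalIntegral.integral_congr fun y hy => ?_
  rw [uIcc_of_le hx.le] at hy
  rw [Complex.ofReal_cpow hy.1, ← Complex.ofReal_sub, Complex.ofReal_cpow (sub_nonneg.2 hy.2)]
  push_cast
  rfl

theorem intervalIntegrable_rpow_mul_sub_rpow {s t x : ℝ} (hs : 0 < s) (ht : 0 < t) (hx : 0 < x) :
    IntervalIntegrable (fun y => y ^ (s - 1) * (x - y) ^ (t - 1)) volume 0 x := by
  refine intervalIntegral.intervalIntegrable_of_integral_ne_zero ?_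
  rw [intervalIntegral_rpow_mul_sub_rpow hs ht hx]
  have := beta_pos hs ht
  positivity

theorem beta_anti {s s₀ t t₀ : ℝ} (hs₀ : 0 < s₀) (ht₀ : 0 < t₀) (hs : s₀ ≤ s) (ht : t₀ ≤ t) :
    beta s t ≤ beta s₀ t₀ := by
  have hs' := hs₀.trans_le hs
  have ht' := ht₀.trans_le ht
  have hbeta {a b : ℝ} (ha : 0 < a) (hb : 0 < b) :
      beta a b = ∫ y in (0 : ℝ)..1, y ^ (a - 1) * (1 - y) ^ (b - 1) := by
    rw [intervalIntegral_rpow_mul_sub_rpow ha hb one_pos, Real.one_rpow, one_mul]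
  rw [hbeta hs' ht', hbeta hs₀ ht₀]
  refine intervalIntegral.integral_mono_on_of_le_Ioo zero_le_one
    (intervalIntegrable_rpow_mul_sub_rpow hs' ht' one_pos)
    (intervalIntegrable_rpow_mul_sub_rpow hs₀ ht₀ one_pos) fun y hy => ?_
  have hy0 := hy.1
  have hy1 := sub_pos.2 hy.2
  exact mul_le_mul (Real.rpow_le_rpow_of_exponent_ge hy0 hy.2.le (by linarith))
    (Real.rpow_le_rpow_of_exponent_ge hy1 (by linarith) (by linarith))
    (by positivity) (by positivity)

/-- The Riemann–Liouville kernel of order `s`, whose Laplace transform is `λ ↦ λ ^ (-s)`;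
convolution with it is fractional integration of order `s`. -/
noncomputable def rlKernel (s : ℝ) : ℝ → ℝ :=
  (Ioi (0 : ℝ)).indicator fun x => x ^ (s - 1) / Real.Gamma s

variable {s s₀ t t₀ x : ℝ}

theorem rlKernel_of_pos (s : ℝ) (hx : 0 < x) : rlKernel s x = x ^ (s - 1) / Real.Gamma s :=
  indicator_of_mem (mem_Ioi.2 hx) _

theorem rlKernel_of_nonpos (s : ℝ) (hx : x ≤ 0) : rlKernel s x = 0 :=
  indicator_of_notMem (notMem_Ioi.2 hx) _

theorem rlKernel_nonneg (hs : 0 ≤ s) (x : ℝ) : 0 ≤ rlKernel s x :=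
  indicator_nonneg (fun x (hx : 0 < x) => by have := Real.Gamma_nonneg_of_nonneg hs; positivity) x

theorem measurable_rlKernel (s : ℝ) : Measurable (rlKernel s) :=
  Measurable.indicator (by fun_prop) measurableSet_Ioi

theorem rlKernel_add_le (hs₀ : 0 < s₀) (ht₀ : 0 < t₀) (hs : s₀ ≤ s) (ht : t₀ ≤ t) (x : ℝ) :
    rlKernel (s + t) x ≤ x * beta s₀ t₀ * (rlKernel s x * rlKernel t x) := by
  rcases le_or_gt x 0 with hx | hx
  · simp [rlKernel_of_nonpos _ hx]
  have := Real.Gamma_pos_of_pos (hs₀.trans_le hs)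
  have := Real.Gamma_pos_of_pos (ht₀.trans_le ht)
  have hpow : x ^ (s + t - 1) = x * (x ^ (s - 1) * x ^ (t - 1)) := by
    rw [← Real.rpow_add hx, mul_comm, ← Real.rpow_add_one hx.ne']
    ring_nf
  simp only [rlKernel_of_pos _ hx]
  calc x ^ (s + t - 1) / Real.Gamma (s + t)
      = x * beta s t * (x ^ (s - 1) / Real.Gamma s * (x ^ (t - 1) / Real.Gamma t)) := by
        rw [hpow, beta]
        field_simp
    _ ≤ x * beta s₀ t₀ * (x ^ (s - 1) / Real.Gamma s * (x ^ (t - 1) / Real.Gamma t)) := by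
        gcongr
        exact beta_anti hs₀ ht₀ hs ht

theorem convolution_rlKernel (hs : 0 < s) (ht : 0 < t) :
    rlKernel s ⋆ rlKernel t = rlKernel (s + t) := by
  rw [rlKernel, rlKernel, ← posConvolution_eq_convolution_indicator _ _ _ volume]
  refine indicator_congr fun x (hx : 0 < x) => ?_
  have := Real.Gamma_pos_of_pos hs
  have := Real.Gamma_pos_of_pos ht
  calc ∫ y in 0..x, y ^ (s - 1) / Real.Gamma s * ((x - y) ^ (t - 1) / Real.Gamma t)
      = (∫ y in 0..x, y ^ (s - 1) * (x - y) ^ (t - 1)) / (Real.Gamma s * Real.Gamma t) := by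
        rw [← intervalIntegral.integral_div]
        refine intervalIntegral.integral_congr fun y _ => ?_
        rw [div_mul_div_comm]
    _ = x ^ (s + t - 1) / Real.Gamma (s + t) := by
        rw [intervalIntegral_rpow_mul_sub_rpow hs ht hx, beta]
        field_simp

theorem integral_rlKernel_mul (hs : 0 < s) (ht : 0 < t) (x : ℝ) :
    ∫ y, rlKernel s y * rlKernel t (x - y) = rlKernel (s + t) x :=
  congrFun (convolution_rlKernel hs ht) x

theorem integrable_rlKernel_mul (hs : 0 < s) (ht : 0 < t) (x : ℝ) :
    Integrable fun y => rlKernel s y * rlKernel t (x - y) := by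
  rcases le_or_gt x 0 with hx | hx
  · have (y : ℝ) : rlKernel s y * rlKernel t (x - y) = 0 := by
      rcases le_or_gt y 0 with hy | hy
      · rw [rlKernel_of_nonpos s hy, zero_mul]
      · rw [rlKernel_of_nonpos t (by linarith : x - y ≤ 0), mul_zero]
    simp [this]
  · refine .of_integral_ne_zero ?_
    have := Real.Gamma_pos_of_pos (add_pos hs ht)
    rw [integral_rlKernel_mul hs ht, rlKernel_of_pos _ hx]
    positivity

end Kernel

/-- The function `∑ i, p_i x ^ (θ i + β - 1) / Γ(θ i + β)` of `x > 0`, extended by zero: the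
function with Laplace transform `λ ↦ λ ^ (-β) * p (λ ^ (-θ))`, so that convolutions of such
functions correspond to products of power series. -/
noncomputable def gammaSeries (θ β : ℝ) (p : ℝ⟦X⟧) (x : ℝ) : ℝ :=
  ∑' i : ℕ, coeff i p * rlKernel (θ * i + β) x

/-- Absolute convergence of the series `gammaSeries θ β p` at every point. -/
def GammaSummable (θ β : ℝ) (p : ℝ⟦X⟧) : Prop :=
  ∀ x, Summable fun i : ℕ => |coeff i p| * rlKernel (θ * i + β) x

section Basic

variable {θ β : ℝ} {p : ℝ⟦X⟧}

theorem GammaSummable.summable (hθ : 0 ≤ θ) (hβ : 0 ≤ β) (hp : GammaSummable θ β p) (x : ℝ) :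
    Summable fun i : ℕ => coeff i p * rlKernel (θ * i + β) x := by
  refine .of_abs ((hp x).congr fun i => ?_)
  rw [abs_mul, abs_of_nonneg (rlKernel_nonneg (s := θ * i + β) (by positivity) x)]

theorem measurable_gammaSeries (hθ : 0 ≤ θ) (hβ : 0 ≤ β) (hp : GammaSummable θ β p) :
    Measurable (gammaSeries θ β p) :=
  measurable_of_tendsto_metrizable
    (fun n => Finset.measurable_fun_sum (Finset.range n) fun i _ =>
      (measurable_rlKernel (θ * i + β)).const_mul (coeff i p))
    (tendsto_pi_nhds.2 fun x => (hp.summable hθ hβ x).hasSum.tendsto_sum_nat)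

theorem gammaSeries_of_nonpos {x : ℝ} (hx : x ≤ 0) : gammaSeries θ β p x = 0 := by
  simp [gammaSeries, rlKernel_of_nonpos _ hx]

theorem gammaSeries_one (θ β : ℝ) : gammaSeries θ β 1 = rlKernel β := by
  ext x
  rw [gammaSeries, tsum_eq_single 0 fun i hi => by rw [coeff_one, if_neg hi, zero_mul]]
  simp

theorem gammaSummable_one (θ β : ℝ) : GammaSummable θ β 1 := fun _ =>
  summable_of_ne_finset_zero (s := {0}) fun i hi => by
    rw [coeff_one, if_neg (by simpa using hi), abs_zero, zero_mul]

theorem gammaSeries_C_mul (θ β c : ℝ) (p : ℝ⟦X⟧) (x : ℝ) :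
    gammaSeries θ β (C c * p) x = c * gammaSeries θ β p x := by
  simp only [gammaSeries, coeff_C_mul, mul_assoc, tsum_mul_left]

theorem GammaSummable.C_mul (hp : GammaSummable θ β p) (c : ℝ) : GammaSummable θ β (C c * p) :=
  fun x => ((hp x).mul_left |c|).congr fun i => by rw [coeff_C_mul, abs_mul, mul_assoc]

end Basic

section Convolution

open Finset.HasAntidiagonal (antidiagonal mem_antidiagonal)

variable {θ β₁ β₂ : ℝ} {p q : ℝ⟦X⟧}

theorem GammaSummable.summable_prod (hθ : 0 ≤ θ) (hβ₁ : 0 < β₁) (hβ₂ : 0 < β₂)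
    (hp : GammaSummable θ β₁ p) (hq : GammaSummable θ β₂ q) (x : ℝ) :
    Summable fun k : ℕ × ℕ =>
      |coeff k.1 p * coeff k.2 q| * rlKernel (θ * k.1 + β₁ + (θ * k.2 + β₂)) x := by
  have hK₁ (i : ℕ) : 0 ≤ rlKernel (θ * i + β₁) x := rlKernel_nonneg (by positivity) x
  have hK₂ (j : ℕ) : 0 ≤ rlKernel (θ * j + β₂) x := rlKernel_nonneg (by positivity) x
  refine (((hp x).mul_of_nonneg (hq x) (fun i => mul_nonneg (abs_nonneg _) (hK₁ i))
    fun j => mul_nonneg (abs_nonneg _) (hK₂ j)).mul_left (x * beta β₁ β₂)).of_nonneg_of_le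
    (fun k => mul_nonneg (abs_nonneg _) (rlKernel_nonneg (by positivity) x)) fun k => ?_
  calc |coeff k.1 p * coeff k.2 q| * rlKernel (θ * k.1 + β₁ + (θ * k.2 + β₂)) x
      ≤ |coeff k.1 p * coeff k.2 q| * (x * beta β₁ β₂ *
          (rlKernel (θ * k.1 + β₁) x * rlKernel (θ * k.2 + β₂) x)) := by
        gcongr
        exact rlKernel_add_le hβ₁ hβ₂ (le_add_of_nonneg_left (by positivity))
          (le_add_of_nonneg_left (by positivity)) x
    _ = _ := by rw [abs_mul]; ring

theorem GammaSummable.mul (hθ : 0 ≤ θ) (hβ₁ : 0 < β₁) (hβ₂ : 0 < β₂)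
    (hp : GammaSummable θ β₁ p) (hq : GammaSummable θ β₂ q) :
    GammaSummable θ (β₁ + β₂) (p * q) := by
  intro x
  have hK (n : ℕ) : 0 ≤ rlKernel (θ * n + (β₁ + β₂)) x := rlKernel_nonneg (by positivity) x
  have hsum := hasSum_sum_antidiagonal (hp.summable_prod hθ hβ₁ hβ₂ hq x).hasSum
  refine hsum.summable.of_nonneg_of_le
    (fun n => mul_nonneg (abs_nonneg _) (hK n)) fun n => ?_
  calc |coeff n (p * q)| * rlKernel (θ * n + (β₁ + β₂)) x
      ≤ (∑ k ∈ antidiagonal n, |coeff k.1 p * coeff k.2 q|) *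
          rlKernel (θ * n + (β₁ + β₂)) x := by
        rw [coeff_mul]
        exact mul_le_mul_of_nonneg_right (Finset.abs_sum_le_sum_abs _ _) (hK n)
    _ = _ := by
        rw [Finset.sum_mul]
        refine Finset.sum_congr rfl fun k hk => ?_
        rw [← mem_antidiagonal.1 hk]
        push_cast
        ring_nf

theorem GammaSummable.summable_integral_norm (hθ : 0 ≤ θ) (hβ₁ : 0 < β₁) (hβ₂ : 0 < β₂)
    (hp : GammaSummable θ β₁ p) (hq : GammaSummable θ β₂ q) (x : ℝ) :
    Summable fun k : ℕ × ℕ => ∫ y, ‖coeff k.1 p * coeff k.2 q *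
      (rlKernel (θ * k.1 + β₁) y * rlKernel (θ * k.2 + β₂) (x - y))‖ := by
  refine (hp.summable_prod hθ hβ₁ hβ₂ hq x).congr fun k => ?_
  have hs : 0 < θ * k.1 + β₁ := by positivity
  have ht : 0 < θ * k.2 + β₂ := by positivity
  rw [← integral_rlKernel_mul hs ht, ← integral_const_mul]
  refine integral_congr_ae (.of_forall fun y => ?_)
  have := rlKernel_nonneg hs.le y
  have := rlKernel_nonneg ht.le (x - y)
  simp only [Real.norm_eq_abs]
  rw [abs_mul _ (rlKernel _ _ * _), abs_of_nonneg (a := rlKernel _ _ * _) (by positivity)]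

theorem gammaSeries_mul_gammaSeries (hθ : 0 ≤ θ) (hβ₁ : 0 ≤ β₁) (hβ₂ : 0 ≤ β₂)
    (hp : GammaSummable θ β₁ p) (hq : GammaSummable θ β₂ q) (x y : ℝ) :
    gammaSeries θ β₁ p x * gammaSeries θ β₂ q y =
      ∑' k : ℕ × ℕ, coeff k.1 p * coeff k.2 q *
        (rlKernel (θ * k.1 + β₁) x * rlKernel (θ * k.2 + β₂) y) := by
  rw [gammaSeries, gammaSeries, tsum_mul_tsum_of_summable_norm (hp.summable hθ hβ₁ x).norm
    (hq.summable hθ hβ₂ y).norm]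
  simp only [mul_mul_mul_comm]

theorem GammaSummable.convolutionExists (hθ : 0 ≤ θ) (hβ₁ : 0 < β₁) (hβ₂ : 0 < β₂)
    (hp : GammaSummable θ β₁ p) (hq : GammaSummable θ β₂ q) :
    ConvolutionExists (gammaSeries θ β₁ p) (gammaSeries θ β₂ q)
      (ContinuousLinearMap.lsmul ℝ ℝ) := by
  intro x
  have hmeas : Measurable fun y => gammaSeries θ β₁ p y * gammaSeries θ β₂ q (x - y) :=
    (measurable_gammaSeries hθ hβ₁.le hp).mul
      ((measurable_gammaSeries hθ hβ₂.le hq).comp (measurable_const.sub measurable_id))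
  change Integrable fun y => gammaSeries θ β₁ p y * gammaSeries θ β₂ q (x - y)
  simp only [gammaSeries_mul_gammaSeries hθ hβ₁.le hβ₂.le hp hq] at hmeas ⊢
  exact integrable_tsum
    (fun k => (integrable_rlKernel_mul (by positivity) (by positivity) x).const_mul _)
    (hp.summable_integral_norm hθ hβ₁ hβ₂ hq x) hmeas.aestronglyMeasurable

theorem GammaSummable.convolution_eq (hθ : 0 ≤ θ) (hβ₁ : 0 < β₁) (hβ₂ : 0 < β₂)
    (hp : GammaSummable θ β₁ p) (hq : GammaSummable θ β₂ q) :
    gammaSeries θ β₁ p ⋆ gammaSeries θ β₂ q = gammaSeries θ (β₁ + β₂) (p * q) := by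
  ext x
  have hterm (k : ℕ × ℕ) : ∫ y, coeff k.1 p * coeff k.2 q *
      (rlKernel (θ * k.1 + β₁) y * rlKernel (θ * k.2 + β₂) (x - y)) =
      coeff k.1 p * coeff k.2 q * rlKernel (θ * k.1 + β₁ + (θ * k.2 + β₂)) x := by
    rw [integral_const_mul, integral_rlKernel_mul (by positivity) (by positivity)]
  have hsum := hasSum_integral_of_summable_integral_norm
    (fun k : ℕ × ℕ => (integrable_rlKernel_mul (s := θ * k.1 + β₁) (t := θ * k.2 + β₂)
      (by positivity) (by positivity) x).const_mul (coeff k.1 p * coeff k.2 q))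
    (hp.summable_integral_norm hθ hβ₁ hβ₂ hq x)
  simp only [hterm, ← gammaSeries_mul_gammaSeries hθ hβ₁.le hβ₂.le hp hq] at hsum
  refine (hasSum_sum_antidiagonal hsum).tsum_eq.symm.trans (tsum_congr fun n => ?_)
  rw [coeff_mul, Finset.sum_mul]
  refine Finset.sum_congr rfl fun k hk => ?_
  rw [← mem_antidiagonal.1 hk]
  push_cast
  ring_nf

theorem GammaSummable.prod {ι : Type*} {s : Finset ι} (hs : s.Nonempty) {β : ι → ℝ}
    {p : ι → ℝ⟦X⟧} (hθ : 0 ≤ θ) (hβ : ∀ l ∈ s, 0 < β l)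
    (hp : ∀ l ∈ s, GammaSummable θ (β l) (p l)) :
    GammaSummable θ (∑ l ∈ s, β l) (∏ l ∈ s, p l) := by
  induction hs using Finset.Nonempty.cons_induction with
  | singleton l => simpa using hp
  | cons l s hl hs ih =>
    rw [Finset.sum_cons, Finset.prod_cons]
    rw [Finset.forall_mem_cons] at hβ hp
    exact hp.1.mul hθ hβ.1 (Finset.sum_pos hβ.2 hs) (ih hβ.2 hp.2)

end Convolution

section Order

variable {θ β : ℝ} {p : ℝ⟦X⟧}

theorem rlKernel_le_inv_mul_rlKernel_add_one {s x : ℝ} (hs : 0 < s) (hx : 0 < x) :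
    rlKernel s x ≤ x⁻¹ * rlKernel (s + 1) (Real.exp 1 * x) := by
  have hΓ := Real.Gamma_pos_of_pos hs
  have hexp : s ≤ Real.exp s := by linarith [Real.add_one_le_exp s]
  rw [rlKernel_of_pos s hx, rlKernel_of_pos _ (by positivity), Real.Gamma_add_one hs.ne',
    add_sub_cancel_right, Real.mul_rpow (Real.exp_nonneg 1) hx.le, Real.exp_one_rpow,
    Real.rpow_sub_one hx.ne']
  field_simp
  exact hexp

theorem GammaSummable.of_add_one (hθ : 0 ≤ θ) (hβ : 0 < β) (hp : GammaSummable θ (β + 1) p) :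
    GammaSummable θ β p := by
  intro x
  rcases le_or_gt x 0 with hx | hx
  · simp only [rlKernel_of_nonpos _ hx, mul_zero, summable_zero]
  · refine ((hp (Real.exp 1 * x)).mul_left x⁻¹).of_nonneg_of_le
      (fun i => mul_nonneg (abs_nonneg _) (rlKernel_nonneg (by positivity) x)) fun i => ?_
    rw [mul_left_comm, ← add_assoc]
    gcongr
    exact rlKernel_le_inv_mul_rlKernel_add_one (by positivity) hx

theorem GammaSummable.of_pos {β' : ℝ} (hθ : 0 ≤ θ) (hβ : 0 < β) (hβ' : 0 < β')
    (hp : GammaSummable θ β p) : GammaSummable θ β' p := by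
  obtain ⟨n, hn⟩ := exists_nat_gt (β - β')
  have hlarge : GammaSummable θ (β' + n) p := by
    have := hp.mul hθ hβ (sub_pos.2 (sub_lt_iff_lt_add'.1 hn)) (gammaSummable_one θ _)
    rwa [mul_one, add_sub_cancel] at this
  clear hn
  induction n with
  | zero => simpa using hlarge
  | succ n ih =>
    refine ih (.of_add_one hθ (by positivity) ?_)
    rwa [add_assoc, ← Nat.cast_succ]

theorem GammaSummable.tendsto_abs_coeff_div_Gamma {ε : ℝ} (hθ : 0 ≤ θ) (hβ : 0 < β) (hε : 0 < ε)
    (hp : GammaSummable θ β p) :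
    Tendsto (fun i : ℕ => |coeff i p| / Real.Gamma (θ * i + ε)) atTop (𝓝 0) := by
  simpa [rlKernel_of_pos, div_eq_mul_inv] using (hp.of_pos hθ hβ hε 1).tendsto_atTop_zero

end Order

section Growth

theorem Gamma_add_le_rpow_mul_Gamma {s r : ℝ} (hs : 0 < s) (hr : 0 < r) (hr1 : r < 1) :
    Real.Gamma (s + r) ≤ s ^ r * Real.Gamma s := by
  have hΓ := Real.Gamma_pos_of_pos hs
  calc Real.Gamma (s + r) = Real.Gamma ((1 - r) * s + r * (s + 1)) := by ring_nf
    _ ≤ Real.Gamma s ^ (1 - r) * Real.Gamma (s + 1) ^ r :=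
      Real.Gamma_mul_add_mul_le_rpow_Gamma_mul_rpow_Gamma hs (by linarith) (sub_pos.2 hr1) hr
        (by ring)
    _ = s ^ r * Real.Gamma s := by
      rw [Real.Gamma_add_one hs.ne', Real.mul_rpow hs.le hΓ.le, mul_left_comm,
        ← Real.rpow_add hΓ, sub_add_cancel, Real.rpow_one]

theorem eventually_mul_rpow_le {r c K ε : ℝ} (hr : 0 < r) (hr1 : r < 1) (hc : 0 < c)
    (hε : 0 < ε) : ∀ᶠ i : ℕ in atTop, K * (r * i + c) ^ r ≤ ε * (i + 1) := by
  have hlim : Tendsto (fun i : ℕ => r * (i : ℝ) + c) atTop atTop :=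
    tendsto_atTop_add_const_right _ _ (tendsto_natCast_atTop_atTop.const_mul_atTop hr)
  have hzero : Tendsto (fun i : ℕ => K * (r * i + c) ^ (-(1 - r))) atTop (𝓝 0) := by
    simpa using ((tendsto_rpow_neg_atTop (sub_pos.2 hr1)).comp hlim).const_mul K
  filter_upwards [hzero.eventually_le_const (show 0 < ε / (1 + c) by positivity)] with i hi
  have hs : 0 < r * i + c := by positivity
  have hle : r * i + c ≤ (1 + c) * (i + 1) := by
    have : (0 : ℝ) ≤ i := i.cast_nonneg
    nlinarith
  calc K * (r * i + c) ^ r = K * (r * i + c) ^ (-(1 - r)) * (r * i + c) := by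
        rw [mul_assoc, ← Real.rpow_add_one hs.ne']
        ring_nf
    _ ≤ ε / (1 + c) * ((1 + c) * (i + 1)) := by gcongr
    _ = ε * (i + 1) := by field_simp

theorem summable_Gamma_mul_pow_div_factorial {r c : ℝ} (hr : 0 < r) (hr1 : r < 1) (hc : 0 < c)
    (K : ℝ) : Summable fun i : ℕ => Real.Gamma (r * i + c) * K ^ i / (i.factorial : ℝ) := by
  refine summable_of_ratio_norm_eventually_le (r := 1 / 2) (by norm_num) ?_
  filter_upwards [eventually_mul_rpow_le (K := |K|) hr hr1 hc (ε := 1 / 2) (by norm_num)] with i hi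
  have hs : 0 < r * i + c := by positivity
  have hΓ := Real.Gamma_pos_of_pos hs
  have hΓ' := Real.Gamma_pos_of_pos (add_pos hs hr)
  have harg : r * (i + 1) + c = r * i + c + r := by ring
  simp only [Nat.factorial_succ, Nat.cast_mul, Nat.cast_succ, harg, norm_div, norm_mul, norm_pow,
    Real.norm_eq_abs, abs_of_pos hΓ, abs_of_pos hΓ', Nat.abs_cast,
    abs_of_pos (Nat.cast_add_one_pos i : (0 : ℝ) < i + 1)]
  calc Real.Gamma (r * i + c + r) * |K| ^ (i + 1) / ((i + 1) * i.factorial)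
      ≤ (r * i + c) ^ r * Real.Gamma (r * i + c) * |K| ^ (i + 1) / ((i + 1) * i.factorial) := by
        gcongr
        exact Gamma_add_le_rpow_mul_Gamma hs hr hr1
    _ = |K| * (r * i + c) ^ r / (i + 1) *
          (Real.Gamma (r * i + c) * |K| ^ i / i.factorial) := by
        rw [pow_succ]
        field_simp
    _ ≤ 1 / 2 * (Real.Gamma (r * i + c) * |K| ^ i / i.factorial) :=
        mul_le_mul_of_nonneg_right ((div_le_iff₀ (by positivity)).2 hi) (by positivity)

end Growth

section Coefficients

variable {αM αQ μM μQ ϱ z : ℝ}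

theorem rpow_mul_natCast_add {x : ℝ} (hx : 0 < x) (a b : ℝ) (n : ℕ) :
    x ^ (a * n + b) = (x ^ a) ^ n * x ^ b := by
  rw [Real.rpow_add hx, Real.rpow_mul hx.le, Real.rpow_natCast]

theorem u_zero_pos (hαM : 0 < αM) (hαQ : 0 < αQ) (hμM : 0 < μM) (hμQ : 0 < μQ) (hϱ : 0 < ϱ) :
    0 < u αM αQ μM μQ ϱ 0 := by
  have := Real.Gamma_pos_of_pos (s := αM * (0 + μM)) (by positivity)
  have := Real.Gamma_pos_of_pos (s := αM * (0 + μM) / αQ + μQ) (by positivity)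
  simp only [u, Nat.cast_zero]
  positivity

theorem ratioTerm_eq (hαM : 0 < αM) (hμM : 0 < μM) (hϱ : 0 < ϱ) (hz : 0 < z) (i : ℕ) :
    ratioTerm αM αQ μM μQ ϱ z i =
      z * (u αM αQ μM μQ ϱ i * rlKernel (αM * i + αM * μM) z) := by
  have := Real.Gamma_pos_of_pos (s := αM * (i + μM)) (by positivity)
  rw [ratioTerm, u, rlKernel_of_pos _ hz, ← mul_add, add_comm μM, Real.mul_rpow hϱ.le hz.le,
    Real.rpow_sub_one hz.ne']
  field_simp

theorem summable_ratioTerm (hαM : 0 < αM) (hαMQ : αM < αQ) (hμM : 0 < μM) (hμQ : 0 < μQ)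
    (hϱ : 0 < ϱ) (hz : 0 < z) : Summable (ratioTerm αM αQ μM μQ ϱ z) := by
  have hαQ := hαM.trans hαMQ
  refine ((summable_Gamma_mul_pow_div_factorial (c := αM * μM / αQ + μQ) (div_pos hαM hαQ)
    ((div_lt_one hαQ).2 hαMQ) (by positivity) (-(ϱ * z) ^ αM)).mul_left
      ((ϱ * z) ^ (αM * μM))).congr fun i => ?_
  have harg : αM * (i + μM) / αQ + μQ = αM / αQ * i + (αM * μM / αQ + μQ) := by ring
  rw [ratioTerm, harg, mul_add, rpow_mul_natCast_add (mul_pos hϱ hz), neg_pow]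
  ring

theorem gammaSummable_u (hαM : 0 < αM) (hαMQ : αM < αQ) (hμM : 0 < μM) (hμQ : 0 < μQ)
    (hϱ : 0 < ϱ) : GammaSummable αM (αM * μM) (.mk (u αM αQ μM μQ ϱ)) := by
  intro x
  rcases le_or_gt x 0 with hx | hx
  · simp only [rlKernel_of_nonpos _ hx, mul_zero, summable_zero]
  refine ((summable_ratioTerm hαM hαMQ hμM hμQ hϱ hx).abs.mul_left x⁻¹).congr fun i => ?_
  have hK := rlKernel_nonneg (s := αM * i + αM * μM) (by positivity) x
  rw [ratioTerm_eq hαM hμM hϱ hx, abs_mul, abs_mul, abs_of_pos hx, abs_of_nonneg hK,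
    inv_mul_cancel_left₀ hx.ne', coeff_mk]

end Coefficients

section Density

theorem IsPDF.conv {ν₁ ν₂ : Measure ℝ} {f g : ℝ → ℝ} (hf : IsPDF ν₁ f) (hg : IsPDF ν₂ g)
    (hfg : ConvolutionExists f g (ContinuousLinearMap.lsmul ℝ ℝ)) :
    IsPDF (ν₁ ∗ ν₂) (f ⋆ g) := by
  obtain ⟨hfm, hf0, rfl⟩ := hf
  obtain ⟨hgm, hg0, rfl⟩ := hg
  have hmeas : Measurable fun p : ℝ × ℝ => f p.2 * g (p.1 - p.2) := by fun_prop
  refine ⟨hmeas.stronglyMeasurable.integral_prod_right.measurable,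
    fun x => integral_nonneg fun y => mul_nonneg (hf0 y) (hg0 (x - y)), ?_⟩
  rw [conv_withDensity_eq_lconvolution hfm.ennreal_ofReal hgm.ennreal_ofReal]
  congr 1
  ext x
  have hint : Integrable fun y => f y * g (x - y) := hfg x
  change ∫⁻ y, _ * ENNReal.ofReal (g (-y + x)) = ENNReal.ofReal (∫ y, f y * g (x - y))
  rw [ofReal_integral_eq_lintegral_ofReal hint
    (.of_forall fun y => mul_nonneg (hf0 y) (hg0 (x - y)))]
  refine lintegral_congr fun y => ?_
  rw [ENNReal.ofReal_mul (hf0 y), neg_add_eq_sub]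

theorem IsPDF.measureReal_Iic {ν : Measure ℝ} {f : ℝ → ℝ} (hf : IsPDF ν f) (z : ℝ) :
    ν.real (Iic z) = (f ⋆ rlKernel 1) z := by
  obtain ⟨hfm, hf0, rfl⟩ := hf
  have hker (y : ℝ) : f y * rlKernel 1 (z - y) = (Iio z).indicator f y := by
    rcases lt_or_ge y z with hy | hy
    · simp [rlKernel_of_pos 1 (sub_pos.2 hy), indicator_of_mem (mem_Iio.2 hy)]
    · simp [rlKernel_of_nonpos 1 (sub_nonpos.2 hy), hy]
  change _ = ∫ y, f y * rlKernel 1 (z - y)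
  simp_rw [hker]
  rw [integral_indicator measurableSet_Iio, ← integral_Iic_eq_integral_Iio, measureReal_def,
    withDensity_apply _ measurableSet_Iic,
    integral_eq_lintegral_of_nonneg_ae (.of_forall hf0) hfm.aestronglyMeasurable]

end Density

section Sum

variable {θ : ℝ}

theorem IsPDF.measureReal_Iic_gammaSeries {β : ℝ} {p : ℝ⟦X⟧} {ν : Measure ℝ} (hθ : 0 ≤ θ)
    (hβ : 0 < β) (hp : GammaSummable θ β p) (hν : IsPDF ν (gammaSeries θ β p)) (z : ℝ) :
    ν.real (Iic z) = gammaSeries θ (β + 1) p z := by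
  rw [hν.measureReal_Iic, ← gammaSeries_one θ,
    hp.convolution_eq hθ hβ one_pos (gammaSummable_one θ 1), mul_one]

theorem isPDF_map_sum {ι S : Type*} [MeasurableSpace S] {P : Measure S} [IsProbabilityMeasure P]
    {s : Finset ι} (hs : s.Nonempty) {β : ι → ℝ} {p : ι → ℝ⟦X⟧} {Z : ι → S → ℝ} (hθ : 0 ≤ θ)
    (hβ : ∀ l, 0 < β l) (hp : ∀ l, GammaSummable θ (β l) (p l)) (hZm : ∀ l, AEMeasurable (Z l) P)
    (hind : iIndepFun Z P) (hZ : ∀ l, IsPDF (P.map (Z l)) (gammaSeries θ (β l) (p l))) :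
    IsPDF (P.map (∑ l ∈ s, Z l)) (gammaSeries θ (∑ l ∈ s, β l) (∏ l ∈ s, p l)) := by
  induction hs using Finset.Nonempty.cons_induction with
  | singleton l => simpa using hZ l
  | cons l s hl hs ih =>
    have hβs : 0 < ∑ l ∈ s, β l := Finset.sum_pos (fun l _ => hβ l) hs
    have hps : GammaSummable θ (∑ l ∈ s, β l) (∏ l ∈ s, p l) :=
      .prod hs hθ (fun l _ => hβ l) fun l _ => hp l
    have hsm : AEMeasurable (∑ l ∈ s, Z l) P := Finset.aemeasurable_sum _ fun l _ => hZm l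
    rw [Finset.sum_cons, Finset.sum_cons, Finset.prod_cons,
      (hind.indepFun_finsetSum_of_notMem₀ hZm hl).symm.map_add_eq_map_conv_map₀ (hZm l) hsm,
      ← (hp l).convolution_eq hθ (hβ l) hβs hps]
    exact (hZ l).conv ih ((hp l).convolutionExists hθ (hβ l) hβs hps)

end Sum

section Quotient

theorem lintegral_eq_ofReal_abs_mul_lintegral {y : ℝ} (hy : y ≠ 0) {h : ℝ → ℝ≥0∞}
    (hh : Measurable h) : ∫⁻ x, h x = ENNReal.ofReal |y| * ∫⁻ z, h (y * z) := by
  conv_lhs => rw [← Real.smul_map_volume_mul_left hy]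
  rw [lintegral_smul_measure, lintegral_map hh (measurable_const_mul y), smul_eq_mul]

theorem map_div_withDensity_prod {f : ℝ → ℝ≥0∞} (hf : Measurable f) {ν : Measure ℝ}
    [SFinite (volume.withDensity f)] [SFinite ν] (hν : ∀ᵐ y ∂ν, y ≠ 0) :
    ((volume.withDensity f).prod ν).map (fun p => p.1 / p.2) =
      volume.withDensity fun z => ∫⁻ y, ENNReal.ofReal |y| * f (y * z) ∂ν := by
  refine Measure.ext_of_lintegral _ fun φ hφ => ?_
  have hscale (y : ℝ) (hy : y ≠ 0) : ∫⁻ x, φ (x / y) ∂volume.withDensity f =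
      ∫⁻ z, ENNReal.ofReal |y| * f (y * z) * φ z := by
    have hφy : Measurable fun x => φ (x / y) := by fun_prop
    rw [lintegral_withDensity_eq_lintegral_mul _ hf hφy,
      lintegral_eq_ofReal_abs_mul_lintegral hy (hf.mul hφy),
      ← lintegral_const_mul _ (by fun_prop)]
    simp only [Pi.mul_apply, mul_div_cancel_left₀ _ hy, mul_assoc]
  rw [lintegral_map hφ (by fun_prop), lintegral_prod_symm _ (by fun_prop),
    lintegral_congr_ae (hν.mono hscale), lintegral_lintegral_swap (by fun_prop),
    lintegral_withDensity_eq_lintegral_mul _ (by fun_prop) hφ]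
  refine lintegral_congr fun z => ?_
  rw [Pi.mul_apply, lintegral_mul_const _ (by fun_prop)]

theorem IsPDF.map_div {ν₁ ν₂ : Measure ℝ} [SFinite ν₁] [SFinite ν₂] {f : ℝ → ℝ}
    (hf : IsPDF ν₁ f) (hν₂ : ∀ᵐ y ∂ν₂, y ≠ 0)
    (hint : ∀ z, Integrable (fun y => |y| * f (y * z)) ν₂) :
    IsPDF ((ν₁.prod ν₂).map fun p => p.1 / p.2) fun z => ∫ y, |y| * f (y * z) ∂ν₂ := by
  obtain ⟨hfm, hf0, rfl⟩ := hf
  have hmeas : Measurable fun p : ℝ × ℝ => |p.2| * f (p.2 * p.1) := by fun_prop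
  have hnonneg (z y : ℝ) : 0 ≤ |y| * f (y * z) := mul_nonneg (abs_nonneg y) (hf0 _)
  refine ⟨hmeas.stronglyMeasurable.integral_prod_right.measurable,
    fun z => integral_nonneg (hnonneg z), ?_⟩
  rw [map_div_withDensity_prod hfm.ennreal_ofReal hν₂]
  congr 1
  ext z
  rw [ofReal_integral_eq_lintegral_ofReal (hint z) (.of_forall (hnonneg z))]
  simp only [ENNReal.ofReal_mul (abs_nonneg _)]

end Quotient

section AlphaMu

variable {α μ Ω : ℝ}

theorem alphaMuPDF_of_pos (hμ : 0 < μ) (hΩ : 0 < Ω) {x : ℝ} (hx : 0 < x) :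
    alphaMuPDF α μ Ω x = α * (μ / Ω ^ α) ^ μ / Real.Gamma μ * x ^ (α * μ - 1) *
      Real.exp (-(μ / Ω ^ α) * x ^ α) := by
  rw [alphaMuPDF, indicator_of_mem (mem_Ioi.2 hx), Real.div_rpow hμ.le (by positivity),
    ← Real.rpow_mul hΩ.le]
  congr 1
  · field_simp
  · congr 1; ring

theorem alphaMuPDF_of_nonpos {x : ℝ} (hx : x ≤ 0) : alphaMuPDF α μ Ω x = 0 :=
  indicator_of_notMem (notMem_Ioi.2 hx) _

theorem measurable_alphaMuPDF (α μ Ω : ℝ) : Measurable (alphaMuPDF α μ Ω) :=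
  Measurable.indicator (by fun_prop) measurableSet_Ioi

theorem isPDF_alphaMuLaw (hα : 0 ≤ α) (hμ : 0 ≤ μ) (hΩ : 0 ≤ Ω) :
    IsPDF (alphaMuLaw α μ Ω) (alphaMuPDF α μ Ω) := by
  refine ⟨measurable_alphaMuPDF α μ Ω, indicator_nonneg fun x (hx : 0 < x) => ?_, rfl⟩
  have := Real.Gamma_nonneg_of_nonneg hμ
  positivity

theorem ae_pos_alphaMuLaw (α μ Ω : ℝ) : ∀ᵐ y ∂alphaMuLaw α μ Ω, 0 < y := by
  rw [alphaMuLaw, ae_withDensity_iff (measurable_alphaMuPDF α μ Ω).ennreal_ofReal]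
  refine .of_forall fun y hy => ?_
  contrapose! hy
  rw [alphaMuPDF_of_nonpos hy, ENNReal.ofReal_zero]

theorem integral_rpow_alphaMuLaw (hα : 0 < α) (hμ : 0 < μ) (hΩ : 0 < Ω) {s : ℝ} (hs : 0 ≤ s) :
    ∫ y, y ^ s ∂alphaMuLaw α μ Ω =
      (μ / Ω ^ α) ^ (-(s / α)) * Real.Gamma (s / α + μ) / Real.Gamma μ := by
  have hpdf := isPDF_alphaMuLaw hα.le hμ.le hΩ.le
  have hB : 0 < μ / Ω ^ α := by positivity
  have hq : -1 < s + (α * μ - 1) := by linarith [mul_pos hα hμ]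
  calc ∫ y, y ^ s ∂alphaMuLaw α μ Ω = ∫ y, alphaMuPDF α μ Ω y * y ^ s := by
        rw [hpdf.2.2, integral_withDensity_eq_integral_toReal_smul hpdf.1.ennreal_ofReal
          (.of_forall fun _ => ENNReal.ofReal_lt_top)]
        simp only [ENNReal.toReal_ofReal (hpdf.2.1 _), smul_eq_mul]
    _ = ∫ y in Ioi 0, alphaMuPDF α μ Ω y * y ^ s :=
        (setIntegral_eq_integral_of_forall_compl_eq_zero fun y hy => by
          rw [alphaMuPDF_of_nonpos (notMem_Ioi.1 hy), zero_mul]).symm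
    _ = ∫ y in Ioi 0, α * (μ / Ω ^ α) ^ μ / Real.Gamma μ *
          (y ^ (s + (α * μ - 1)) * Real.exp (-(μ / Ω ^ α) * y ^ α)) := by
        refine setIntegral_congr_fun measurableSet_Ioi fun y (hy : 0 < y) => ?_
        simp only [alphaMuPDF_of_pos hμ hΩ hy, Real.rpow_add hy]
        ring
    _ = _ := by
        have harg : (s + (α * μ - 1) + 1) / α = s / α + μ := by field_simp; ring
        rw [integral_const_mul, integral_rpow_mul_exp_neg_mul_rpow hα hq hB, neg_div, harg,
          neg_add, Real.rpow_add hB, Real.rpow_neg hB.le μ]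
        field_simp

theorem integrable_rpow_alphaMuLaw (hα : 0 < α) (hμ : 0 < μ) (hΩ : 0 < Ω) {s : ℝ} (hs : 0 ≤ s) :
    Integrable (fun y => y ^ s) (alphaMuLaw α μ Ω) := by
  refine .of_integral_ne_zero ?_
  have := Real.Gamma_pos_of_pos hμ
  have := Real.Gamma_pos_of_pos (s := s / α + μ) (by positivity)
  rw [integral_rpow_alphaMuLaw hα hμ hΩ hs]
  positivity

theorem hasSum_mul_alphaMuPDF (hμ : 0 < μ) (hΩ : 0 < Ω) {x : ℝ} (hx : 0 < x) :
    HasSum (fun i : ℕ => α / Real.Gamma μ * ((-1) ^ i / i.factorial) *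
      ((μ / Ω ^ α) ^ (i + μ) * x ^ (α * (i + μ)))) (x * alphaMuPDF α μ Ω x) := by
  have hA : 0 < μ / Ω ^ α := by positivity
  have hval : x * alphaMuPDF α μ Ω x = α / Real.Gamma μ * (μ / Ω ^ α) ^ μ * x ^ (α * μ) *
      Real.exp (-(μ / Ω ^ α) * x ^ α) := by
    rw [alphaMuPDF_of_pos hμ hΩ hx, Real.rpow_sub_one hx.ne']
    field_simp
  have hterm (i : ℕ) : α / Real.Gamma μ * ((-1) ^ i / i.factorial) *
      ((μ / Ω ^ α) ^ (i + μ) * x ^ (α * (i + μ))) =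
      α / Real.Gamma μ * (μ / Ω ^ α) ^ μ * x ^ (α * μ) *
        ((-(μ / Ω ^ α) * x ^ α) ^ i / i.factorial) := by
    rw [Real.rpow_add hA, Real.rpow_natCast, mul_add, rpow_mul_natCast_add hx, neg_mul,
      neg_pow (_ * _), mul_pow]
    ring
  rw [hval, Real.exp_eq_exp_ℝ]
  simp only [hterm]
  exact HasSum.mul_left _ (NormedSpace.expSeries_div_hasSum_exp _)

end AlphaMu

section Ratio

variable {αM αQ μM μQ ΩM ΩQ : ℝ}

theorem rhoTilde_pos (hμM : 0 < μM) (hμQ : 0 < μQ) (hΩM : 0 < ΩM) (hΩQ : 0 < ΩQ) :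
    0 < rhoTilde αM αQ μM μQ ΩM ΩQ := by
  unfold rhoTilde
  positivity

theorem rhoTilde_rpow (hαM : 0 < αM) (hαQ : 0 < αQ) (hμM : 0 < μM) (hμQ : 0 < μQ) (hΩM : 0 < ΩM)
    (hΩQ : 0 < ΩQ) (s : ℝ) :
    rhoTilde αM αQ μM μQ ΩM ΩQ ^ (αM * s) =
      (μM / ΩM ^ αM) ^ s * (μQ / ΩQ ^ αQ) ^ (-(αM * s / αQ)) := by
  have hM : (μM ^ (1 / αM) / ΩM) ^ αM = μM / ΩM ^ αM := by
    rw [Real.div_rpow (by positivity) hΩM.le, ← Real.rpow_mul hμM.le, one_div,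
      inv_mul_cancel₀ hαM.ne', Real.rpow_one]
  have hQ : (μQ ^ (1 / αQ) / ΩQ) ^ αQ = μQ / ΩQ ^ αQ := by
    rw [Real.div_rpow (by positivity) hΩQ.le, ← Real.rpow_mul hμQ.le, one_div,
      inv_mul_cancel₀ hαQ.ne', Real.rpow_one]
  have hϱ : rhoTilde αM αQ μM μQ ΩM ΩQ = μM ^ (1 / αM) / ΩM * (μQ ^ (1 / αQ) / ΩQ)⁻¹ := by
    rw [rhoTilde]
    field_simp
  rw [← hM, ← hQ, ← Real.rpow_mul (by positivity), ← Real.rpow_mul (by positivity), mul_neg,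
    mul_div_cancel₀ _ hαQ.ne', Real.rpow_neg (by positivity), ← Real.inv_rpow (by positivity), hϱ,
    Real.mul_rpow (by positivity) (by positivity)]

theorem integral_tsum_mul_rpow {ν : Measure ℝ} (hν : ∀ᵐ y ∂ν, 0 < y) {k s : ℕ → ℝ} {g : ℝ → ℝ}
    (hg : AEStronglyMeasurable g ν) (hint : ∀ i, Integrable (fun y => y ^ s i) ν)
    (hsum : Summable fun i => k i * ∫ y, y ^ s i ∂ν)
    (hseries : ∀ y, 0 < y → HasSum (fun i => k i * y ^ s i) (g y)) :
    Integrable g ν ∧ ∫ y, g y ∂ν = ∑' i, k i * ∫ y, y ^ s i ∂ν := by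
  have hgae : (fun y => ∑' i, k i * y ^ s i) =ᵐ[ν] g :=
    hν.mono fun y hy => (hseries y hy).tsum_eq
  have hnorm : Summable fun i => ∫ y, ‖k i * y ^ s i‖ ∂ν := by
    refine hsum.norm.congr fun i => ?_
    rw [← integral_const_mul]
    have hi : ∀ᵐ y ∂ν, ‖k i * y ^ s i‖ = |k i| * y ^ s i := hν.mono fun y hy => by
      rw [norm_mul, Real.norm_eq_abs, Real.norm_of_nonneg (by positivity)]
    rw [integral_congr_ae hi, integral_const_mul, integral_const_mul, norm_mul, Real.norm_eq_abs,
      Real.norm_of_nonneg (integral_nonneg_of_ae (hν.mono fun y hy => by positivity))]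
  have hint' (i : ℕ) : Integrable (fun y => k i * y ^ s i) ν := (hint i).const_mul (k i)
  refine ⟨(integrable_tsum hint' hnorm (hg.congr hgae.symm)).congr hgae, ?_⟩
  rw [← integral_congr_ae hgae, ← integral_tsum_of_summable_integral_norm hint' hnorm]
  simp only [integral_const_mul]

theorem coeff_mul_rlKernel_eq (hαM : 0 < αM) (hμM : 0 < μM) {ϱ z : ℝ} (hϱ : 0 < ϱ) (hz : 0 < z)
    (i : ℕ) :
    coeff i (C (αM / (Real.Gamma μM * Real.Gamma μQ)) * mk (u αM αQ μM μQ ϱ)) *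
        rlKernel (αM * i + αM * μM) z =
      αM / (z * Real.Gamma μM * Real.Gamma μQ) * ratioTerm αM αQ μM μQ ϱ z i := by
  rw [coeff_C_mul, coeff_mk, ratioTerm_eq hαM hμM hϱ hz]
  field_simp

theorem indicator_tsum_ratioTerm_eq_gammaSeries (hαM : 0 < αM) (hμM : 0 < μM) {ϱ : ℝ}
    (hϱ : 0 < ϱ) :
    ((Ioi (0 : ℝ)).indicator fun z =>
      αM / (z * Real.Gamma μM * Real.Gamma μQ) * ∑' i, ratioTerm αM αQ μM μQ ϱ z i) =
      gammaSeries αM (αM * μM)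
        (C (αM / (Real.Gamma μM * Real.Gamma μQ)) * mk (u αM αQ μM μQ ϱ)) := by
  ext z
  rcases le_or_gt z 0 with hz | hz
  · rw [indicator_of_notMem (notMem_Ioi.2 hz), gammaSeries_of_nonpos hz]
  · rw [indicator_of_mem (mem_Ioi.2 hz), ← tsum_mul_left]
    exact (tsum_congr (coeff_mul_rlKernel_eq hαM hμM hϱ hz)).symm

theorem integral_abs_mul_alphaMuPDF_mul (hαM : 0 < αM) (hαMQ : αM < αQ) (hμM : 0 < μM)
    (hμQ : 0 < μQ) (hΩM : 0 < ΩM) (hΩQ : 0 < ΩQ) {z : ℝ} (hz : 0 < z) :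
    Integrable (fun y => |y| * alphaMuPDF αM μM ΩM (y * z)) (alphaMuLaw αQ μQ ΩQ) ∧
      ∫ y, |y| * alphaMuPDF αM μM ΩM (y * z) ∂alphaMuLaw αQ μQ ΩQ =
        ∑' i, αM / (z * Real.Gamma μM * Real.Gamma μQ) *
          ratioTerm αM αQ μM μQ (rhoTilde αM αQ μM μQ ΩM ΩQ) z i := by
  have hαQ := hαM.trans hαMQ
  have hϱ := rhoTilde_pos (αM := αM) (αQ := αQ) hμM hμQ hΩM hΩQ
  set k : ℕ → ℝ := fun i => z⁻¹ * (αM / Real.Gamma μM * ((-1) ^ i / i.factorial) *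
    ((μM / ΩM ^ αM) ^ (i + μM) * z ^ (αM * (i + μM)))) with hk
  have hs (i : ℕ) : 0 ≤ αM * (i + μM) := by positivity
  have hterm (i : ℕ) : k i * ∫ y, y ^ (αM * (i + μM)) ∂alphaMuLaw αQ μQ ΩQ =
      αM / (z * Real.Gamma μM * Real.Gamma μQ) *
        ratioTerm αM αQ μM μQ (rhoTilde αM αQ μM μQ ΩM ΩQ) z i := by
    rw [integral_rpow_alphaMuLaw hαQ hμQ hΩQ (hs i), ratioTerm, Real.mul_rpow hϱ.le hz.le,
      rhoTilde_rpow hαM hαQ hμM hμQ hΩM hΩQ, hk]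
    field_simp
  have hseries (y : ℝ) (hy : 0 < y) : HasSum (fun i => k i * y ^ (αM * (i + μM)))
      (|y| * alphaMuPDF αM μM ΩM (y * z)) := by
    have hval : |y| * alphaMuPDF αM μM ΩM (y * z) =
        z⁻¹ * (y * z * alphaMuPDF αM μM ΩM (y * z)) := by
      rw [abs_of_pos hy]
      field_simp
    rw [hval]
    refine ((hasSum_mul_alphaMuPDF hμM hΩM (mul_pos hy hz)).mul_left z⁻¹).congr_fun fun i => ?_
    rw [hk, Real.mul_rpow hy.le hz.le]
    ring
  have hmeas : Measurable fun y => |y| * alphaMuPDF αM μM ΩM (y * z) :=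
    measurable_abs.mul ((measurable_alphaMuPDF αM μM ΩM).comp (measurable_id.mul_const z))
  have hmain := integral_tsum_mul_rpow (ae_pos_alphaMuLaw αQ μQ ΩQ) hmeas.aestronglyMeasurable
    (fun i => integrable_rpow_alphaMuLaw hαQ hμQ hΩQ (hs i))
    (by simpa only [hterm] using (summable_ratioTerm hαM hαMQ hμM hμQ hϱ hz).mul_left _) hseries
  simpa only [hterm] using hmain

theorem isPDF_alphaMuLaw_div (hαM : 0 < αM) (hαMQ : αM < αQ) (hμM : 0 < μM) (hμQ : 0 < μQ)
    (hΩM : 0 < ΩM) (hΩQ : 0 < ΩQ) :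
    IsPDF (((alphaMuLaw αM μM ΩM).prod (alphaMuLaw αQ μQ ΩQ)).map fun p => p.1 / p.2)
      (gammaSeries αM (αM * μM) (C (αM / (Real.Gamma μM * Real.Gamma μQ)) *
        mk (u αM αQ μM μQ (rhoTilde αM αQ μM μQ ΩM ΩQ)))) := by
  have hpos := ae_pos_alphaMuLaw αQ μQ ΩQ
  have hzero {z : ℝ} (hz : z ≤ 0) :
      (fun y => |y| * alphaMuPDF αM μM ΩM (y * z)) =ᵐ[alphaMuLaw αQ μQ ΩQ] 0 :=
    hpos.mono fun y hy => by
      simp [alphaMuPDF_of_nonpos (mul_nonpos_of_nonneg_of_nonpos hy.le hz)]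
  have hint (z : ℝ) :
      Integrable (fun y => |y| * alphaMuPDF αM μM ΩM (y * z)) (alphaMuLaw αQ μQ ΩQ) := by
    rcases le_or_gt z 0 with hz | hz
    · exact (integrable_zero _ _ _).congr (hzero hz).symm
    · exact (integral_abs_mul_alphaMuPDF_mul hαM hαMQ hμM hμQ hΩM hΩQ hz).1
  have hsfin : SFinite (alphaMuLaw αM μM ΩM) := by unfold alphaMuLaw; infer_instance
  have hsfin' : SFinite (alphaMuLaw αQ μQ ΩQ) := by unfold alphaMuLaw; infer_instance
  convert (isPDF_alphaMuLaw hαM.le hμM.le hΩM.le).map_div (hpos.mono fun y hy => hy.ne') hint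
    using 1
  ext z
  rcases le_or_gt z 0 with hz | hz
  · rw [integral_congr_ae (hzero hz), gammaSeries_of_nonpos hz]
    simp
  · rw [(integral_abs_mul_alphaMuPDF_mul hαM hαMQ hμM hμQ hΩM hΩQ hz).2]
    exact tsum_congr (coeff_mul_rlKernel_eq hαM hμM (rhoTilde_pos hμM hμQ hΩM hΩQ) hz)

end Ratio

theorem map_div_eq_map_prod {S : Type*} [MeasurableSpace S] {P : Measure S} [IsFiniteMeasure P]
    {X Y : S → ℝ} {ν₁ ν₂ : Measure ℝ} (hX : HasLaw X ν₁ P) (hY : HasLaw Y ν₂ P)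
    (hXY : IndepFun X Y P) :
    P.map (fun ω => X ω / Y ω) = (ν₁.prod ν₂).map fun p => p.1 / p.2 := by
  rw [← hX.map_eq, ← hY.map_eq,
    ← (indepFun_iff_map_prod_eq_prod_map_map hX.aemeasurable hY.aemeasurable).1 hXY,
    AEMeasurable.map_map_of_aemeasurable (by fun_prop) (hX.aemeasurable.prodMk hY.aemeasurable)]
  rfl

section Sum

variable {L : ℕ} {θ : ℝ} {β : Fin L → ℝ} {η : Fin L → ℕ → ℝ}

theorem pdfTerm_eq_coeff_mul_rlKernel (hη : ∀ l, η l 0 ≠ 0) {x : ℝ} (hx : 0 < x) (i : ℕ) :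
    pdfTerm θ β η x i = coeff i (∏ l, mk (η l)) * rlKernel (θ * i + ∑ l, β l) x := by
  have hexp : -1 + θ * i + ∑ l, β l = θ * i + ∑ l, β l - 1 := by ring
  rw [← mk_delta hη, coeff_mk, rlKernel_of_pos _ hx, pdfTerm, hexp,
    mul_comm (i : ℝ) θ, mul_div_assoc]

theorem cdfTerm_eq_coeff_mul_rlKernel (hη : ∀ l, η l 0 ≠ 0) (hθ : 0 ≤ θ) (hβ : 0 < ∑ l, β l)
    {x : ℝ} (hx : 0 ≤ x) (i : ℕ) :
    cdfTerm θ β η x i = coeff i (∏ l, mk (η l)) * rlKernel (θ * i + (∑ l, β l + 1)) x := by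
  rw [← mk_delta hη, coeff_mk, cdfTerm]
  rcases hx.eq_or_lt with rfl | hx
  · rw [rlKernel_of_nonpos _ le_rfl, Real.zero_rpow (by positivity)]
    ring
  · rw [rlKernel_of_pos _ hx, ← add_assoc, add_sub_cancel_right, mul_comm (i : ℝ) θ, add_assoc 1,
      add_comm 1, mul_div_assoc]

theorem indicator_tsum_pdfTerm_eq_gammaSeries (hη : ∀ l, η l 0 ≠ 0) (c : ℝ) :
    ((Ioi (0 : ℝ)).indicator fun z => c * ∑' i, pdfTerm θ β η z i) =
      gammaSeries θ (∑ l, β l) (C c * ∏ l, mk (η l)) := by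
  ext z
  rcases le_or_gt z 0 with hz | hz
  · rw [indicator_of_notMem (notMem_Ioi.2 hz), gammaSeries_of_nonpos hz]
  · rw [indicator_of_mem (mem_Ioi.2 hz), gammaSeries_C_mul]
    simp only [pdfTerm_eq_coeff_mul_rlKernel hη hz, gammaSeries]

theorem tsum_cdfTerm_eq_gammaSeries (hη : ∀ l, η l 0 ≠ 0) (hθ : 0 ≤ θ) (hβ : 0 < ∑ l, β l)
    {x : ℝ} (hx : 0 ≤ x) (c : ℝ) :
    c * ∑' i, cdfTerm θ β η x i = gammaSeries θ (∑ l, β l + 1) (C c * ∏ l, mk (η l)) x := by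
  rw [gammaSeries_C_mul]
  simp only [gammaSeries, cdfTerm_eq_coeff_mul_rlKernel hη hθ hβ hx]

theorem prod_C_mul_mk (Ψ : Fin L → ℝ) (η : Fin L → ℕ → ℝ) :
    ∏ l, (C (Ψ l) * mk (η l)) = C (∏ l, Ψ l) * ∏ l, mk (η l) := by
  rw [Finset.prod_mul_distrib, map_prod]

variable [NeZero L]

theorem summable_pdfTerm (hη : ∀ l, η l 0 ≠ 0) (hθ : 0 ≤ θ) (hβ : ∀ l, 0 < β l)
    (hp : ∀ l, GammaSummable θ (β l) (mk (η l))) {x : ℝ} (hx : 0 < x) :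
    Summable (pdfTerm θ β η x) :=
  ((GammaSummable.prod Finset.univ_nonempty hθ (fun l _ => hβ l) fun l _ => hp l).summable hθ
    (Finset.sum_nonneg fun l _ => (hβ l).le) x).congr
      fun i => (pdfTerm_eq_coeff_mul_rlKernel hη hx i).symm

theorem summable_cdfTerm (hη : ∀ l, η l 0 ≠ 0) (hθ : 0 ≤ θ) (hβ : ∀ l, 0 < β l)
    (hp : ∀ l, GammaSummable θ (β l) (mk (η l))) {x : ℝ} (hx : 0 ≤ x) :
    Summable (cdfTerm θ β η x) := by
  have hB : 0 < ∑ l, β l := Finset.sum_pos (fun l _ => hβ l) Finset.univ_nonempty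
  have hprod : GammaSummable θ (∑ l, β l) (∏ l, mk (η l)) :=
    .prod Finset.univ_nonempty hθ (fun l _ => hβ l) fun l _ => hp l
  have hB' : 0 < ∑ l, β l + 1 := by positivity
  exact ((hprod.of_pos hθ hB hB').summable hθ hB'.le x).congr
    fun i => (cdfTerm_eq_coeff_mul_rlKernel hη hθ hB hx i).symm

variable {S : Type*} [MeasurableSpace S] {P : Measure S} [IsProbabilityMeasure P]
  {Z : Fin L → S → ℝ} {Ψ : Fin L → ℝ}

theorem isPDF_map_sum_tsum_pdfTerm (hη : ∀ l, η l 0 ≠ 0) (hθ : 0 ≤ θ) (hβ : ∀ l, 0 < β l)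
    (hp : ∀ l, GammaSummable θ (β l) (mk (η l))) (hZm : ∀ l, AEMeasurable (Z l) P)
    (hind : iIndepFun Z P)
    (hZ : ∀ l, IsPDF (P.map (Z l)) (gammaSeries θ (β l) (C (Ψ l) * mk (η l)))) :
    IsPDF (P.map fun ω => ∑ l, Z l ω)
      ((Ioi (0 : ℝ)).indicator fun z => (∏ l, Ψ l) * ∑' i, pdfTerm θ β η z i) := by
  have hsum : (fun ω => ∑ l, Z l ω) = ∑ l, Z l := (Finset.sum_fn _ _).symm
  rw [indicator_tsum_pdfTerm_eq_gammaSeries hη, ← prod_C_mul_mk, hsum]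
  exact isPDF_map_sum Finset.univ_nonempty hθ hβ (fun l => (hp l).C_mul (Ψ l)) hZm hind hZ

theorem measureReal_sum_le_eq_tsum_cdfTerm (hη : ∀ l, η l 0 ≠ 0) (hθ : 0 ≤ θ)
    (hβ : ∀ l, 0 < β l) (hp : ∀ l, GammaSummable θ (β l) (mk (η l)))
    (hZm : ∀ l, AEMeasurable (Z l) P) (hind : iIndepFun Z P)
    (hZ : ∀ l, IsPDF (P.map (Z l)) (gammaSeries θ (β l) (C (Ψ l) * mk (η l)))) {z : ℝ}
    (hz : 0 ≤ z) :
    P.real {ω | ∑ l, Z l ω ≤ z} = (∏ l, Ψ l) * ∑' i, cdfTerm θ β η z i := by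
  have hB : 0 < ∑ l, β l := Finset.sum_pos (fun l _ => hβ l) Finset.univ_nonempty
  have hprod : GammaSummable θ (∑ l, β l) (C (∏ l, Ψ l) * ∏ l, mk (η l)) :=
    (GammaSummable.prod Finset.univ_nonempty hθ (fun l _ => hβ l) fun l _ => hp l).C_mul _
  have hpdf := isPDF_map_sum_tsum_pdfTerm hη hθ hβ hp hZm hind hZ
  rw [indicator_tsum_pdfTerm_eq_gammaSeries hη] at hpdf
  rw [tsum_cdfTerm_eq_gammaSeries hη hθ hB hz, ← hpdf.measureReal_Iic_gammaSeries hθ hB hprod,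
    map_measureReal_apply_of_aemeasurable (Finset.aemeasurable_fun_sum _ fun l _ => hZm l)
      measurableSet_Iic]
  rfl

end Sum

end FadingSum

open MeasureTheory ProbabilityTheory Filter Topology FadingSum in
theorem proposition3
    {S : Type*} [MeasurableSpace S] (P : Measure S) [IsProbabilityMeasure P]
    (L : ℕ) (hL : 1 ≤ L)
    (αM αQ : ℝ) (hαM : 0 < αM) (hαMQ : αM < αQ)
    (μM μQ ΩM ΩQ : Fin L → ℝ)
    (hμM : ∀ l, 0 < μM l) (hμQ : ∀ l, 0 < μQ l)
    (hΩM : ∀ l, 0 < ΩM l) (hΩQ : ∀ l, 0 < ΩQ l)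
    (M Q : Fin L → S → ℝ)
    (hM : ∀ l, HasLaw (M l) (alphaMuLaw αM (μM l) (ΩM l)) P)
    (hQ : ∀ l, HasLaw (Q l) (alphaMuLaw αQ (μQ l) (ΩQ l)) P)
    (hMQ : ∀ l, IndepFun (M l) (Q l) P)
    (Z : Fin L → S → ℝ) (hZ : ∀ l ω, Z l ω = M l ω / Q l ω)
    (hind : iIndepFun Z P)
    (ϱ : Fin L → ℝ)
    (hϱ : ∀ l, ϱ l = rhoTilde αM αQ (μM l) (μQ l) (ΩM l) (ΩQ l))
    (η : Fin L → ℕ → ℝ)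
    (hη : ∀ l i, η l i = u αM αQ (μM l) (μQ l) (ϱ l) i)
    (β : Fin L → ℝ) (hβ : ∀ l, β l = αM * μM l)
    (Ψ : Fin L → ℝ)
    (hΨ : ∀ l, Ψ l = αM / (Real.Gamma (μM l) * Real.Gamma (μQ l))) :
    -- the density of each ratio
    (∀ l, (∀ z, 0 < z → Summable (ratioTerm αM αQ (μM l) (μQ l) (ϱ l) z)) ∧
      IsPDF (P.map (Z l)) ((Set.Ioi (0 : ℝ)).indicator fun z =>
        αM / (z * Real.Gamma (μM l) * Real.Gamma (μQ l))
          * ∑' i, ratioTerm αM αQ (μM l) (μQ l) (ϱ l) z i)) ∧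
    -- the growth condition
    (∀ l, ∀ ε : ℝ, 0 < ε →
      Tendsto (fun i : ℕ => |η l i| / Real.Gamma (i * αM + ε)) atTop (𝓝 0)) ∧
    -- the density of the sum
    (∀ z, 0 < z → Summable (pdfTerm αM β η z)) ∧
    IsPDF (P.map fun ω => ∑ l, Z l ω) ((Set.Ioi (0 : ℝ)).indicator fun z =>
      (∏ l, Ψ l) * ∑' i, pdfTerm αM β η z i) ∧
    -- the distribution function of the sum
    (∀ z, 0 ≤ z → Summable (cdfTerm αM β η z)) ∧
    (∀ z, 0 ≤ z →
      P.real {ω | ∑ l, Z l ω ≤ z} = (∏ l, Ψ l) * ∑' i, cdfTerm αM β η z i) := by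
  have hαQ := hαM.trans hαMQ
  have : NeZero L := ⟨Nat.one_le_iff_ne_zero.1 hL⟩
  have hϱ0 (l) : 0 < ϱ l := hϱ l ▸ rhoTilde_pos (hμM l) (hμQ l) (hΩM l) (hΩQ l)
  have hη' (l) : η l = u αM αQ (μM l) (μQ l) (ϱ l) := funext (hη l)
  have hZ' (l) : Z l = fun ω => M l ω / Q l ω := funext (hZ l)
  have hβ0 (l) : 0 < β l := hβ l ▸ mul_pos hαM (hμM l)
  have hη0 (l) : η l 0 ≠ 0 := hη l 0 ▸ (u_zero_pos hαM hαQ (hμM l) (hμQ l) (hϱ0 l)).ne'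
  have hZm (l) : AEMeasurable (Z l) P :=
    hZ' l ▸ (hM l).aemeasurable.div (hQ l).aemeasurable
  have hser (l) : GammaSummable αM (β l) (.mk (η l)) := by
    rw [hη', hβ]; exact gammaSummable_u hαM hαMQ (hμM l) (hμQ l) (hϱ0 l)
  have hpdf (l) : IsPDF (P.map (Z l)) (gammaSeries αM (β l) (.C (Ψ l) * .mk (η l))) := by
    rw [hZ', map_div_eq_map_prod (hM l) (hQ l) (hMQ l), hη', hβ, hΨ, hϱ]
    exact isPDF_alphaMuLaw_div hαM hαMQ (hμM l) (hμQ l) (hΩM l) (hΩQ l)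
  refine ⟨fun l => ⟨fun z => summable_ratioTerm hαM hαMQ (hμM l) (hμQ l) (hϱ0 l), ?_⟩,
    fun l ε hε => ?_, fun z => summable_pdfTerm hη0 hαM.le hβ0 hser,
    isPDF_map_sum_tsum_pdfTerm hη0 hαM.le hβ0 hser hZm hind hpdf,
    fun z => summable_cdfTerm hη0 hαM.le hβ0 hser,
    fun z => measureReal_sum_le_eq_tsum_cdfTerm hη0 hαM.le hβ0 hser hZm hind hpdf⟩
  · rw [indicator_tsum_ratioTerm_eq_gammaSeries hαM (hμM l) (hϱ0 l), ← hΨ, ← hη', ← hβ]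
    exact hpdf l
  · simpa only [PowerSeries.coeff_mk, mul_comm αM] using
      (hser l).tendsto_abs_coeff_div_Gamma hαM.le (hβ0 l) hε
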